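/- Let $X$ be a finite set with $|X|=n$ and let $(X,r)$, $r(x,y)=({}^xy,x^y)$, be a square-free solution of the Yang--Baxter equation, i.e. $r:X\times X\to X\times X$ is nondegenerate ($\mathcal L_x:y\mapsto{}^xy$ and $\mathcal R_y:x\mapsto x^y$ are bijective), involutive, satisfies the braid relation, and $r(x,x)=(x,x)$ for all $x$. Let $p$ be its cyclic degree (the least common multiple of the orders of the permutations $\mathcal L_x$), let $G=G(X,r)=\langle X\mid xy=zt \text{ whenever } r(x,y)=(z,t)\rangle$, let $\mathcal L:G\to\mathrm{Sym}(X)$ be the homomorphism extending $x\mapsto\mathcal L_x$, let $\mathcal G=\mathcal L(G)$, and let $\mathcal F_p\le G$ be the subgroup generated by all $x^p$, $x\in X$. A braided group is a group $H$ with a bijection $\sigma(a,u)=({}^au,a^u)$ of $H\times H$ such that $(a,u)\mapsto{}^au$ and $(a,u)\mapsto a^u$ are a left and a right action fixing $1$, with ${}^a(uv)=({}^au)({}^{a^u}v)$, $(ab)^u=(a^{{}^bu})(b^u)$ and $uv=({}^uv)(u^v)$; it is involutive if $\sigma^2=\mathrm{id}$; homomorphisms of braided groups are group homomorphisms commuting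 with the maps $\sigma$. The group $G$ carries a unique braided group structure $r_G$ extending $r$, and it is involutive. Its socle is $\Gamma=\{a\in G\mid {}^au=u\ \forall u\in G\}$, and an ideal is a normal subgroup $H$ with ${}^gH\subseteq H$ for all $g\in G$. Theorem B. (1) $\mathcal F_p$ and $\Gamma$ are ideals of $(G,r_G)$ and $\mathcal F_p\subseteq\Gamma$. The group $\mathcal F_p$ is free abelian of rank $n$, with basis $\{x^p\mid x\in X\}$. (2) $\widetilde G=G/\mathcal F_p$ has order $p^n$, and the canonical projection $\pi:G\to\widetilde G$ induces on it the structure of an involutive braided group. Let $k$ be a field and let $X=\{x_1<\dots<x_n\}$ be any enumeration for which the algebra $A=k\langle X\mid xy=zt \text{ whenever } r(x,y)=(z,t)\rangle$ is a skew polynomial ring with binomial relations (for all $i<j$, $r(x_j,x_i)=(x_{i'},x_{j'})$ with $i'<j'$ and $i'<j$; every pair $(x_i,x_j)$ with $i<j$ arises in this way; and the ordered monomials $x_1^{\alpha_1}\cdots x_n^{\alpha_n}$, $\alpha_i\ge 0$, form a $k$-basis of $A$). Put $Y=\{x_1^{\alpha_1}\cdots x_n^{\alpha_n}\mid 0\le\alpha_i\le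 p-1,\ 1\le i\le n\}\subset G$. Then $|Y|=p^n$ and $\pi|_Y:Y\to\widetilde G$ is bijective; for all $y,z\in Y$ there are unique $t\in Y$ and $W\in\mathcal F_p$ with $yz=tW$, and $\pi(y)\pi(z)=\pi(t)$. (3) The image of $X$ generates $\widetilde G$, and $X\to\widetilde G$ carries $r$ to the braiding operator of $\widetilde G$. If $(X,r)$ is not a trivial solution on at least two elements (that is, if $p\ge2$ or $n\le1$), then $X\to\widetilde G$ is injective, so $X$ is embedded in $\widetilde G$. (4) The braided structure of $G$ induces involutive braided group structures on $G/\Gamma$ and on $\mathcal G$, and $\mathcal L$ induces an isomorphism of braided groups $G/\Gamma\cong\mathcal G$. There is a canonical epimorphism of braided groups $\widetilde G\twoheadrightarrow\mathcal G$, $\pi(g)\mapsto\mathcal L(g)$. Hence $|\mathcal G|$ divides $p^n$, and if $p$ is prime then $\mathcal G$ is a $p$-group. -/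

import Mathlib

namespace YBE

universe u v w

section QuadraticSets

variable {X : Type u}

/-- The left action `ˣy` read off from `r (x, y) = (ˣy, xʸ)`. -/
def lact (r : X × X → X × X) (x y : X) : X := (r (x, y)).1

/-- The right action `xʸ` read off from `r (x, y) = (ˣy, xʸ)`. -/
def ract (r : X × X → X × X) (x y : X) : X := (r (x, y)).2

/-- `r × id` on triples. -/
def r12 (r : X × X → X × X) (t : X × X × X) : X × X × X :=
  ((r (t.1, t.2.1)).1, (r (t.1, t.2.1)).2, t.2.2)

/-- `id × r` on triples. -/
def r23 (r : X × X → X × X) (t : X × X × X) : X × X × X :=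
  (t.1, r t.2)

/-- A solution: a nondegenerate symmetric set `(X, r)`. -/
structure IsSolution (r : X × X → X × X) : Prop where
  left_bijective : ∀ x : X, Function.Bijective (fun y => lact r x y)
  right_bijective : ∀ y : X, Function.Bijective (fun x => ract r x y)
  involutive : ∀ q : X × X, r (r q) = q
  braid : ∀ t : X × X × X, r12 r (r23 r (r12 r t)) = r23 r (r12 r (r23 r t))

/-- `(X, r)` is square-free. -/
def IsSquareFree (r : X × X → X × X) : Prop := ∀ x : X, r (x, x) = (x, x)

/-- The permutation `𝓛ₓ : y ↦ ˣy` of `X`. -/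
noncomputable def leftPerm {r : X × X → X × X} (hr : IsSolution r) (x : X) : Equiv.Perm X :=
  Equiv.ofBijective (fun y => lact r x y) (hr.left_bijective x)

/-- The cyclic degree of a finite solution: the least common multiple of the orders of the
permutations `𝓛ₓ`. -/
noncomputable def cyclicDegree [Fintype X] {r : X × X → X × X} (hr : IsSolution r) : ℕ :=
  Finset.univ.lcm (fun x : X => orderOf (leftPerm hr x))

/-- The defining relators `x y (z t)⁻¹`, `r (x, y) = (z, t)`, of the group `G(X, r)`.
The pairs with `r (x, y) = (x, y)` contribute the trivial relator. -/
def groupRels (r : X × X → X × X) : Set (FreeGroup X) :=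
  Set.range fun q : X × X =>
    FreeGroup.of q.1 * FreeGroup.of q.2 * (FreeGroup.of (r q).1 * FreeGroup.of (r q).2)⁻¹

/-- The group `G(X, r)`. -/
abbrev YBGroup (r : X × X → X × X) : Type u := PresentedGroup (groupRels r)

/-- The canonical map `X → G(X, r)`. -/
def gen (r : X × X → X × X) (x : X) : YBGroup r := PresentedGroup.of x

theorem leftPerm_mul {r : X × X → X × X} (hr : IsSolution r) (q : X × X) :
    leftPerm hr q.1 * leftPerm hr q.2 = leftPerm hr (r q).1 * leftPerm hr (r q).2 := by
  ext w
  exact (congrArg Prod.fst (hr.braid (q.1, q.2, w))).symm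

/-- The canonical left action `𝓛 : G(X, r) → Sym(X)`, extending `x ↦ 𝓛ₓ`. -/
noncomputable def leftAction {r : X × X → X × X} (hr : IsSolution r) :
    YBGroup r →* Equiv.Perm X :=
  PresentedGroup.toGroup (f := leftPerm hr) (by
    rintro _ ⟨q, rfl⟩
    simp only [map_mul, map_inv, FreeGroup.lift_apply_of]
    rw [leftPerm_mul hr q, mul_inv_cancel])

/-- The permutation group `𝒢(X, r)`, the image of `𝓛`. -/
noncomputable def permGroup {r : X × X → X × X} (hr : IsSolution r) :
    Subgroup (Equiv.Perm X) :=
  (leftAction hr).range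

/-- The subgroup `𝓕_p` of `G(X, r)` generated by the `p`-th powers of the generators. -/
def powSubgroup (r : X × X → X × X) (p : ℕ) : Subgroup (YBGroup r) :=
  Subgroup.closure (Set.range fun x : X => gen r x ^ p)

/-- The set `Y` of ordered monomials `x₁^α₁ ⋯ xₙ^αₙ`, `0 ≤ αᵢ ≤ p - 1`, for the enumeration
`e` of `X`, as a subset of `G(X, r)`. -/
def boxMonomials (r : X × X → X × X) (p : ℕ) {n : ℕ} (e : Fin n ≃ X) : Set (YBGroup r) :=
  {g | ∃ α : Fin n → ℕ, (∀ i, α i < p) ∧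
    g = (List.ofFn fun i : Fin n => gen r (e i) ^ α i).prod}

end QuadraticSets

section Algebra

variable {X : Type u}

/-- The defining relations `x y = z t`, `r (x, y) = (z, t)`, of the algebra `A(k, X, r)`. -/
inductive AlgRel (k : Type w) [Field k] (r : X × X → X × X) :
    FreeAlgebra k X → FreeAlgebra k X → Prop
  | mk (q : X × X) : AlgRel k r
      (FreeAlgebra.ι k q.1 * FreeAlgebra.ι k q.2)
      (FreeAlgebra.ι k (r q).1 * FreeAlgebra.ι k (r q).2)

/-- The Yang-Baxter algebra `A(k, X, r)`. -/
abbrev YBAlgebra (k : Type w) [Field k] (r : X × X → X × X) : Type (max u w) :=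
  RingQuot (AlgRel k r)

/-- The image in `A(k, X, r)` of a generator. -/
noncomputable def algGen (k : Type w) [Field k] (r : X × X → X × X) (x : X) : YBAlgebra k r :=
  RingQuot.mkAlgHom k (AlgRel k r) (FreeAlgebra.ι k x)

/-- The ordered monomial `x₁^α₁ ⋯ xₙ^αₙ` in `A(k, X, r)`. -/
noncomputable def orderedMonomial (k : Type w) [Field k] (r : X × X → X × X) {n : ℕ}
    (e : Fin n ≃ X) (α : Fin n → ℕ) : YBAlgebra k r :=
  (List.ofFn fun i : Fin n => algGen k r (e i) ^ α i).prod

/-- With respect to the enumeration `x₁ < ⋯ < xₙ` of `X` given by `e`, the algebra `A(k, X, r)`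
is a skew polynomial ring with binomial relations: its relations are
`x_j x_i = x_i' x_j'` (`i < j`) with `i' < j'` and `i' < j`, every ordered monomial `x_i x_j`
(`i < j`) occurs on a right-hand side, and the ordered monomials form a `k`-basis. -/
structure IsBinomialEnumeration (k : Type w) [Field k] (r : X × X → X × X) {n : ℕ}
    (e : Fin n ≃ X) : Prop where
  rel : ∀ i j : Fin n, i < j → ∃ i' j' : Fin n,
    r (e j, e i) = (e i', e j') ∧ i' < j' ∧ i' < j
  occurs : ∀ i j : Fin n, i < j → ∃ i' j' : Fin n, i' < j' ∧ r (e j', e i') = (e i, e j)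
  linearIndependent : LinearIndependent k (orderedMonomial k r e)
  span_eq_top : Submodule.span k (Set.range (orderedMonomial k r e)) = ⊤

end Algebra

section BraidedGroups

/-- A braiding operator `σ (a, u) = (ᵃu, aᵘ)` on a group `G`, making it a braided group. -/
@[ext]
structure BraidedGroup (G : Type u) [Group G] where
  σ : G × G → G × G
  bijective : Function.Bijective σ
  left_one : ∀ a, lact σ a 1 = 1
  one_left : ∀ u, lact σ 1 u = u
  mul_left : ∀ a b u, lact σ (a * b) u = lact σ a (lact σ b u)
  left_mul : ∀ a u v, lact σ a (u * v) = lact σ a u * lact σ (ract σ a u) v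
  one_right : ∀ u, ract σ 1 u = 1
  right_one : ∀ a, ract σ a 1 = a
  right_mul : ∀ a u v, ract σ a (u * v) = ract σ (ract σ a u) v
  mul_right : ∀ a b u, ract σ (a * b) u = ract σ a (lact σ b u) * ract σ b u
  compat : ∀ u v, u * v = lact σ u v * ract σ u v

namespace BraidedGroup

variable {G : Type u} [Group G] {H : Type v} [Group H]

/-- The braided group is involutive (a "symmetric group"). -/
def IsInvolutive (B : BraidedGroup G) : Prop := ∀ q : G × G, B.σ (B.σ q) = q

/-- The socle `Γ`: the kernel of the left action of `G` upon itself. -/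
def socle (B : BraidedGroup G) : Subgroup G where
  carrier := {a | ∀ u, lact B.σ a u = u}
  one_mem' := B.one_left
  mul_mem' := by
    intro a b ha hb u
    rw [B.mul_left, hb u, ha u]
  inv_mem' := by
    intro a ha u
    have h := B.mul_left a⁻¹ a u
    rw [inv_mul_cancel, B.one_left, ha u] at h
    exact h.symm

/-- An ideal: a normal subgroup invariant under the left action of `G`. -/
def IsIdeal (B : BraidedGroup G) (N : Subgroup G) : Prop :=
  N.Normal ∧ ∀ g : G, ∀ h ∈ N, lact B.σ g h ∈ N

/-- A group homomorphism commuting with the braiding operators. -/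
def IsBraidedHom (B : BraidedGroup G) (C : BraidedGroup H) (f : G →* H) : Prop :=
  ∀ a u : G, C.σ (f a, f u) = (f (B.σ (a, u)).1, f (B.σ (a, u)).2)

/-- For `G = G(X, r)`: the braiding operator restricts to `r` on (the image of) `X × X`. -/
def Extends {X : Type u} {r : X × X → X × X} (B : BraidedGroup (YBGroup r)) : Prop :=
  ∀ x y : X, B.σ (gen r x, gen r y) = (gen r (r (x, y)).1, gen r (r (x, y)).2)

end BraidedGroup

end BraidedGroups

end YBE

open YBE

open YBE

namespace YBE

/-! ### The structure group and its bijective 1-cocycle into `ℤ^(X)` -/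

section StructureGroup

variable {X : Type*} {r : X × X → X × X}

/-! The group `G` acts on `ℤ^(X)` by affine maps, with `x` acting as `v ↦ eₓ + 𝓛ₓ v`. The orbit map
of `0` is a 1-cocycle `c`, so `c(gh) = c(g) + 𝓛_g c(h)`, and it is bijective (`cocycle_surjective`,
`cocycle_injective`). Every assertion is read off in these coordinates.

The braided structure is given by `c(ᵃu) = 𝓛_a c(u)`; its socle is therefore `ker 𝓛`, and on
elements of the socle the left action is conjugation (`lact_eq_conj`). Square-freeness gives `c(xᵐ)
= m eₓ`. As `𝓛ₓᵖ = 1`, the group `𝓕_p` lies in `ker 𝓛`, where `c` is additive, and `c` maps it onto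
`p ℤ^(X)` (`mem_powSubgroup_iff`). So `𝓕_p` is a free abelian ideal, and `c` modulo `p` identifies
`G/𝓕_p` with `(ℤ/p)^X`, which gives the order `pⁿ` and the embedding of `X`.

Involutive braided structures descend modulo ideals inside the socle
(`exists_isBraidedHom_of_surjective`), which yields the structures on `G/𝓕_p`, `G/Γ` and `𝒢`. The
ordered monomials reach every class modulo `𝓕_p` because they span the algebra, and a count makes
the box a transversal (`bijOn_boxMonomials`). -/

theorem gen_mul_gen (r : X × X → X × X) (q : X × X) :
    gen r q.1 * gen r q.2 = gen r (r q).1 * gen r (r q).2 := by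
  simpa only [map_mul] using!
    PresentedGroup.mk_eq_mk_of_mul_inv_mem (rels := groupRels r)
      (x := FreeGroup.of q.1 * FreeGroup.of q.2)
      (y := FreeGroup.of (r q).1 * FreeGroup.of (r q).2) ⟨q, rfl⟩

theorem closure_range_gen (r : X × X → X × X) :
    Subgroup.closure (Set.range (gen r)) = ⊤ :=
  PresentedGroup.closure_range_of _

theorem gen_induction {P : YBGroup r → Prop} (one : P 1)
    (mul : ∀ g x, P g → P (g * gen r x)) (mul_inv : ∀ g x, P g → P (g * (gen r x)⁻¹))
    (g : YBGroup r) : P g := by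
  have hg : g ∈ Subgroup.closure (Set.range (gen r)) := closure_range_gen r ▸ Subgroup.mem_top g
  induction hg using Subgroup.closure_induction_right with
  | one => exact one
  | mul_right g _ y hy ih => obtain ⟨x, rfl⟩ := hy; exact mul g x ih
  | mul_inv_cancel g _ y hy ih => obtain ⟨x, rfl⟩ := hy; exact mul_inv g x ih

variable (hr : IsSolution r)

@[simp]
theorem leftAction_gen (x : X) : leftAction hr (gen r x) = leftPerm hr x :=
  PresentedGroup.toGroup.of _

theorem leftPerm_apply (x y : X) : leftPerm hr x y = (r (x, y)).1 := rfl

theorem leftPerm_fst_snd (q : X × X) : leftPerm hr (r q).1 (r q).2 = q.1 :=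
  congrArg Prod.fst (hr.involutive q)

theorem leftPerm_self (hsf : IsSquareFree r) (x : X) : leftPerm hr x x = x :=
  congrArg Prod.fst (hsf x)

theorem leftPerm_symm_self (hsf : IsSquareFree r) (x : X) : (leftPerm hr x)⁻¹ x = x := by
  rw [Equiv.Perm.inv_eq_iff_eq, leftPerm_self hr hsf]

/-- The defining relation in a form symmetric in `a` and `w`: by involutivity, `r (a, 𝓛_a⁻¹ w) = (w,
𝓛_w⁻¹ a)`. It makes the translations of `G` commute. -/
theorem gen_mul_gen_symm (a w : X) :
    gen r a * gen r ((leftPerm hr a)⁻¹ w) = gen r w * gen r ((leftPerm hr w)⁻¹ a) := by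
  have h1 : (r (a, (leftPerm hr a)⁻¹ w)).1 = w := (leftPerm hr a).apply_symm_apply w
  have h2 : (r (a, (leftPerm hr a)⁻¹ w)).2 = (leftPerm hr w)⁻¹ a := by
    rw [eq_comm, Equiv.Perm.inv_eq_iff_eq]
    have := leftPerm_fst_snd hr (a, (leftPerm hr a)⁻¹ w)
    rw [h1] at this
    exact this.symm
  have := gen_mul_gen r (a, (leftPerm hr a)⁻¹ w)
  rwa [h1, h2] at this

/-- The affine transformation `v ↦ eₓ + 𝓛ₓ v` of `ℤ^(X)`. -/
noncomputable def affinePerm (x : X) : Equiv.Perm (X →₀ ℤ) :=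
  (Finsupp.domCongr (leftPerm hr x)).toEquiv.trans (Equiv.addLeft (Finsupp.single x 1))

theorem affinePerm_apply (x : X) (v : X →₀ ℤ) :
    affinePerm hr x v = Finsupp.single x 1 + Finsupp.mapDomain (leftPerm hr x) v := by
  simp [affinePerm, Finsupp.equivMapDomain_eq_mapDomain]

theorem affinePerm_mul (q : X × X) :
    affinePerm hr q.1 * affinePerm hr q.2 = affinePerm hr (r q).1 * affinePerm hr (r q).2 := by
  ext1 v
  simp only [Equiv.Perm.mul_apply, affinePerm_apply, Finsupp.mapDomain_add,
    Finsupp.mapDomain_single, ← Finsupp.mapDomain_comp, ← Equiv.Perm.coe_mul]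
  rw [leftPerm_mul hr q, leftPerm_fst_snd, leftPerm_apply, ← add_assoc, ← add_assoc,
    add_comm (Finsupp.single q.1 1)]

/-- The affine action of `G(X, r)` on `ℤ^(X)` in which a generator acts as `v ↦ eₓ + 𝓛ₓ v`. -/
noncomputable def affineAction : YBGroup r →* Equiv.Perm (X →₀ ℤ) :=
  PresentedGroup.toGroup (f := affinePerm hr) (by
    rintro _ ⟨q, rfl⟩
    simp only [map_mul, map_inv, FreeGroup.lift_apply_of]
    rw [affinePerm_mul hr q, mul_inv_cancel])

/-- The canonical bijective 1-cocycle `G(X, r) → ℤ^(X)`. -/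
noncomputable def cocycle (g : YBGroup r) : X →₀ ℤ := affineAction hr g 0

theorem affineAction_gen (x : X) : affineAction hr (gen r x) = affinePerm hr x :=
  PresentedGroup.toGroup.of _

@[simp]
theorem cocycle_one : cocycle hr 1 = 0 := by simp [cocycle]

@[simp]
theorem cocycle_gen (x : X) : cocycle hr (gen r x) = Finsupp.single x 1 := by
  simp [cocycle, affineAction_gen, affinePerm_apply]

theorem affineAction_apply (g : YBGroup r) (v : X →₀ ℤ) :
    affineAction hr g v = cocycle hr g + Finsupp.mapDomain (leftAction hr g) v := by
  induction g using gen_induction generalizing v with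
  | one => simp
  | mul g x ih =>
    rw [cocycle]
    simp only [map_mul, Equiv.Perm.mul_apply, affineAction_gen, leftAction_gen, ih,
      affinePerm_apply, Finsupp.mapDomain_add, ← Finsupp.mapDomain_comp, ← Equiv.Perm.coe_mul]
    simp [add_assoc]
  | mul_inv g x ih =>
    -- The vector `eₓ + u` is the image of `𝓛ₓ⁻¹ u` under `x`, so `x⁻¹` cancels and the induction
    -- hypothesis for `g` applies. The cases `u = -eₓ` and `u = -eₓ + v` give the values at `0` and
    -- at `v`.
    have key : ∀ u, affineAction hr (g * (gen r x)⁻¹) (Finsupp.single x 1 + u) =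
        cocycle hr g + Finsupp.mapDomain (leftAction hr (g * (gen r x)⁻¹)) u := by
      intro u
      have hu : u = Finsupp.mapDomain (leftPerm hr x)
          (Finsupp.mapDomain ⇑(leftPerm hr x)⁻¹ u) := by
        rw [← Finsupp.mapDomain_comp, ← Equiv.Perm.coe_mul, mul_inv_cancel]
        simp
      conv_lhs => rw [hu]
      rw [← affinePerm_apply, ← affineAction_gen, ← Equiv.Perm.mul_apply, ← map_mul,
        inv_mul_cancel_right, ih, ← Finsupp.mapDomain_comp, ← Equiv.Perm.coe_mul]
      simp
    have h₁ := key (-Finsupp.single x 1)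
    have h₂ := key (-Finsupp.single x 1 + v)
    rw [add_neg_cancel] at h₁
    rw [add_neg_cancel_left] at h₂
    rw [h₂, cocycle.eq_1 hr (g * _), h₁, Finsupp.mapDomain_add, add_assoc]

theorem cocycle_mul (g h : YBGroup r) :
    cocycle hr (g * h) = cocycle hr g + Finsupp.mapDomain (leftAction hr g) (cocycle hr h) := by
  rw [cocycle, map_mul, Equiv.Perm.mul_apply, affineAction_apply]
  rfl

theorem mapDomain_leftAction_mul (g h : YBGroup r) (v : X →₀ ℤ) :
    Finsupp.mapDomain (leftAction hr (g * h)) v =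
      Finsupp.mapDomain (leftAction hr g) (Finsupp.mapDomain (leftAction hr h) v) := by
  rw [map_mul, Equiv.Perm.coe_mul, Finsupp.mapDomain_comp]

theorem cocycle_mul_gen (g : YBGroup r) (x : X) :
    cocycle hr (g * gen r x) = cocycle hr g + Finsupp.single (leftAction hr g x) 1 := by
  rw [cocycle_mul, cocycle_gen, Finsupp.mapDomain_single]

/-- Square-freeness enters here: `𝓛ₓ` fixes `x`, so `g` and `g x⁻¹` send `x` to the same point. -/
theorem cocycle_mul_gen_inv (hsf : IsSquareFree r) (g : YBGroup r) (x : X) :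
    cocycle hr (g * (gen r x)⁻¹) = cocycle hr g - Finsupp.single (leftAction hr g x) 1 := by
  have h := cocycle_mul_gen hr (g * (gen r x)⁻¹) x
  rw [inv_mul_cancel_right, map_mul, map_inv, leftAction_gen, Equiv.Perm.mul_apply,
    leftPerm_symm_self hr hsf] at h
  rw [h, add_sub_cancel_right]

theorem cocycle_surjective (hsf : IsSquareFree r) : Function.Surjective (cocycle hr) := by
  classical
  -- One coordinate is moved at a time: right multiplication of `h` by the generator `𝓛_h⁻¹ x` or
  -- its inverse changes the cocycle by `± eₓ`.
  have key : ∀ (x : X) (m : ℤ) (g : YBGroup r),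
      ∃ h, cocycle hr h = cocycle hr g + Finsupp.single x m := by
    intro x m
    induction m using Int.induction_on with
    | zero => exact fun g => ⟨g, by simp⟩
    | succ m ih =>
      intro g
      obtain ⟨h, hh⟩ := ih g
      refine ⟨h * gen r ((leftAction hr h)⁻¹ x), ?_⟩
      rw [cocycle_mul_gen, Equiv.Perm.coe_inv, Equiv.apply_symm_apply, hh, add_assoc, ← Finsupp.single_add]
    | pred m ih =>
      intro g
      obtain ⟨h, hh⟩ := ih g
      refine ⟨h * (gen r ((leftAction hr h)⁻¹ x))⁻¹, ?_⟩
      rw [cocycle_mul_gen_inv hr hsf, Equiv.Perm.coe_inv, Equiv.apply_symm_apply, hh, add_sub_assoc,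
        ← Finsupp.single_sub]
  intro v
  induction v using Finsupp.induction with
  | zero => exact ⟨1, cocycle_one hr⟩
  | single_add x m v _ _ ih =>
    obtain ⟨g, rfl⟩ := ih
    obtain ⟨h, hh⟩ := key x m g
    exact ⟨h, by rw [hh, add_comm]⟩

/-- The permutation `g ↦ g · (𝓛_g⁻¹ x)` of `G(X, r)`, corresponding to translation by `eₓ` under
the cocycle. -/
noncomputable def translation (hsf : IsSquareFree r) (x : X) : Equiv.Perm (YBGroup r) where
  toFun g := g * gen r ((leftAction hr g)⁻¹ x)
  invFun g := g * (gen r ((leftAction hr g)⁻¹ x))⁻¹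
  left_inv g := by
    simp only [map_mul, leftAction_gen, mul_inv_rev, Equiv.Perm.mul_apply,
      leftPerm_symm_self hr hsf, mul_inv_cancel_right]
  right_inv g := by
    simp only [map_mul, map_inv, leftAction_gen, mul_inv_rev, inv_inv, Equiv.Perm.mul_apply,
      leftPerm_self hr hsf, inv_mul_cancel_right]

theorem translation_apply (hsf : IsSquareFree r) (x : X) (g : YBGroup r) :
    translation hr hsf x g = g * gen r ((leftAction hr g)⁻¹ x) := rfl

theorem commute_translation (hsf : IsSquareFree r) (x y : X) :
    Commute (translation hr hsf x) (translation hr hsf y) := by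
  ext1 g
  simp only [Equiv.Perm.mul_apply, translation_apply, map_mul, leftAction_gen, mul_inv_rev,
    mul_assoc]
  rw [gen_mul_gen_symm]

/-- The commuting translations define an action `S` of `ℤ^X` on the set `G`, and `v ↦ S v 1` is a
left inverse of the cocycle. -/
theorem cocycle_injective [Fintype X] (hsf : IsSquareFree r) :
    Function.Injective (cocycle hr) := by
  classical
  let T : (X → Multiplicative ℤ) →* Equiv.Perm (YBGroup r) :=
    MonoidHom.noncommPiCoprod (fun x => zpowersHom _ (translation hr hsf x))
      (fun x y _ a b => by
        simp only [zpowersHom_apply]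
        exact (commute_translation hr hsf x y).zpow_zpow _ _)
  let S : (X →₀ ℤ) → Equiv.Perm (YBGroup r) := fun v => T fun x => Multiplicative.ofAdd (v x)
  have hS : ∀ v x, S (v + Finsupp.single x 1) = translation hr hsf x * S v := by
    intro v x
    have h1 : T (Pi.mulSingle x (Multiplicative.ofAdd 1)) = translation hr hsf x := by
      
      refine (MonoidHom.noncommPiCoprod_mulSingle _ x _).trans ?_
      simp
    rw [← h1, ← map_mul]
    refine congrArg T (funext fun y => ?_)
    by_cases h : y = x
    · subst h; simp [mul_comm]
    · simp [h]
  have key : ∀ g, S (cocycle hr g) 1 = g := by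
    intro g
    induction g using gen_induction with
    | one =>
      have : S 0 = 1 := map_one T
      simp [this]
    | mul g x ih =>
      rw [cocycle_mul_gen, hS, Equiv.Perm.mul_apply, ih, translation_apply,
        Equiv.Perm.coe_inv, Equiv.symm_apply_apply]
    | mul_inv g x ih =>
      apply (translation hr hsf (leftAction hr g x)).injective
      rw [← Equiv.Perm.mul_apply, ← hS, cocycle_mul_gen_inv hr hsf, sub_add_cancel, ih,
        translation_apply]
      simp [leftPerm_self hr hsf]
  exact Function.LeftInverse.injective (g := fun v => S v 1) key

/-- The canonical bijective 1-cocycle, as an equivalence. -/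
noncomputable def cocycleEquiv [Fintype X] (hsf : IsSquareFree r) : YBGroup r ≃ (X →₀ ℤ) :=
  Equiv.ofBijective (cocycle hr) ⟨cocycle_injective hr hsf, cocycle_surjective hr hsf⟩

theorem cocycle_cocycleEquiv_symm [Fintype X] (hsf : IsSquareFree r) (v : X →₀ ℤ) :
    cocycle hr ((cocycleEquiv hr hsf).symm v) = v :=
  (cocycleEquiv hr hsf).apply_symm_apply v

end StructureGroup

/-! ### Braided groups: reduction to the left action, quotients, uniqueness -/

namespace BraidedGroup

variable {G H K : Type*} [Group G] [Group H] [Group K]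

/-- The right action is redundant, so braidings are built and compared through the left action
alone. -/
theorem ract_eq (B : BraidedGroup G) (a u : G) :
    ract B.σ a u = (lact B.σ a u)⁻¹ * (a * u) := by
  rw [B.compat a u, inv_mul_cancel_left]

theorem ext_lact {B C : BraidedGroup G} (h : ∀ a u, lact B.σ a u = lact C.σ a u) : B = C := by
  refine BraidedGroup.ext (funext fun q => Prod.ext (h q.1 q.2) ?_)
  change ract B.σ q.1 q.2 = ract C.σ q.1 q.2
  rw [ract_eq, ract_eq, h]

theorem lact_inv_lact (B : BraidedGroup G) (a u : G) : lact B.σ a⁻¹ (lact B.σ a u) = u := by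
  rw [← B.mul_left, inv_mul_cancel, B.one_left]

theorem lact_lact_inv (B : BraidedGroup G) (a u : G) : lact B.σ a (lact B.σ a⁻¹ u) = u := by
  rw [← B.mul_left, mul_inv_cancel, B.one_left]

theorem mem_socle {B : BraidedGroup G} {a : G} : a ∈ B.socle ↔ ∀ u, lact B.σ a u = u := Iff.rfl

theorem lact_lact_ract {B : BraidedGroup G} (hB : B.IsInvolutive) (a u : G) :
    lact B.σ (lact B.σ a u) (ract B.σ a u) = a :=
  congrArg Prod.fst (hB (a, u))

theorem IsBraidedHom.map_lact {B : BraidedGroup G} {C : BraidedGroup H} {f : G →* H}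
    (hf : B.IsBraidedHom C f) (a u : G) : lact C.σ (f a) (f u) = f (lact B.σ a u) :=
  congrArg Prod.fst (hf a u)

theorem isBraidedHom_of_lact {B : BraidedGroup G} {C : BraidedGroup H} {f : G →* H}
    (hf : ∀ a u, lact C.σ (f a) (f u) = f (lact B.σ a u)) : B.IsBraidedHom C f := by
  intro a u
  refine Prod.ext (hf a u) ?_
  change ract C.σ (f a) (f u) = f (ract B.σ a u)
  rw [ract_eq, ract_eq, hf]
  simp only [map_mul, map_inv]

/-- Used for the maps induced on quotients: being braided can be checked after precomposing with the
projection. -/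
theorem IsBraidedHom.of_comp {B : BraidedGroup G} {C : BraidedGroup H} {D : BraidedGroup K}
    {f : G →* H} {g : H →* K} {f' : G →* K} (hsurj : Function.Surjective f)
    (hf : B.IsBraidedHom C f) (hf' : B.IsBraidedHom D f') (h : ∀ a, g (f a) = f' a) :
    C.IsBraidedHom D g := by
  refine isBraidedHom_of_lact fun a u => ?_
  obtain ⟨a, rfl⟩ := hsurj a
  obtain ⟨u, rfl⟩ := hsurj u
  rw [hf.map_lact, h, h, h, hf'.map_lact]

/-- An involutive braided group from a left action `l` on itself which is compatible with the
product through the right factor `(ᵃu)⁻¹ a u`. -/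
noncomputable def ofLeftAction (l : G → G → G) (left_one : ∀ a, l a 1 = 1)
    (one_left : ∀ u, l 1 u = u) (mul_left : ∀ a b u, l (a * b) u = l a (l b u))
    (left_mul : ∀ a u v, l a (u * v) = l a u * l ((l a u)⁻¹ * (a * u)) v)
    (invol : ∀ a u, l (l a u) ((l a u)⁻¹ * (a * u)) = a) : BraidedGroup G where
  σ q := (l q.1 q.2, (l q.1 q.2)⁻¹ * (q.1 * q.2))
  bijective := Function.Involutive.bijective fun q => by simp [invol]
  left_one := left_one
  one_left := one_left
  mul_left := mul_left
  left_mul := left_mul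
  one_right u := by simp [ract, one_left]
  right_one a := by simp [ract, left_one]
  right_mul a u v := by
    simp only [ract, left_mul]
    group
  mul_right a b u := by
    simp only [ract, lact, mul_left]
    group
  compat u v := by simp [lact, ract]

theorem ofLeftAction_isInvolutive {l : G → G → G} {left_one one_left mul_left left_mul}
    (invol : ∀ a u, l (l a u) ((l a u)⁻¹ * (a * u)) = a) :
    (ofLeftAction l left_one one_left mul_left left_mul invol).IsInvolutive := by
  intro q
  simp [ofLeftAction, invol]

/-- An involutive braided structure descends along a surjective homomorphism whose kernel is an
ideal contained in the socle. -/
theorem exists_isBraidedHom_of_surjective {B : BraidedGroup G} (hB : B.IsInvolutive) (f : G →* H)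
    (hf : Function.Surjective f) (hideal : ∀ g, ∀ h ∈ f.ker, lact B.σ g h ∈ f.ker)
    (hsocle : f.ker ≤ B.socle) :
    ∃ C : BraidedGroup H, C.IsInvolutive ∧ B.IsBraidedHom C f := by
  -- Changing `a` by `m` in the kernel has no effect, as `m` is in the socle. Changing `u` by `w` in
  -- the kernel multiplies `ᵃu` by a translate of `w`, which stays in the kernel by the ideal
  -- property.
  have wd : ∀ a a' u u', f a = f a' → f u = f u' → f (lact B.σ a u) = f (lact B.σ a' u') := by
    intro a a' u u' ha hu
    obtain ⟨m, hm, rfl⟩ : ∃ m ∈ f.ker, a = a' * m :=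
      ⟨a'⁻¹ * a, by simp [MonoidHom.mem_ker, ha], by group⟩
    obtain ⟨w, hw, rfl⟩ : ∃ w ∈ f.ker, u = u' * w :=
      ⟨u'⁻¹ * u, by simp [MonoidHom.mem_ker, hu], by group⟩
    rw [B.mul_left, hsocle hm, B.left_mul, map_mul, MonoidHom.mem_ker.1 (hideal _ w hw), mul_one]
  have hs : ∀ x, f (Function.surjInv hf x) = x := Function.surjInv_eq hf
  obtain ⟨l, hl⟩ : ∃ l : H → H → H, ∀ a u, l (f a) (f u) = f (lact B.σ a u) :=
    ⟨fun x y => f (lact B.σ (Function.surjInv hf x) (Function.surjInv hf y)),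
      fun a u => wd _ _ _ _ (hs _) (hs _)⟩
  have hr : ∀ a u, (l (f a) (f u))⁻¹ * (f a * f u) = f (ract B.σ a u) := fun a u => by
    rw [hl, ract_eq]
    simp only [map_mul, map_inv]
  have invol : ∀ a u, l (l a u) ((l a u)⁻¹ * (a * u)) = a := by
    intro a u
    obtain ⟨a, rfl⟩ := hf a
    obtain ⟨u, rfl⟩ := hf u
    rw [hr, hl, hl, lact_lact_ract hB]
  refine ⟨ofLeftAction l ?_ ?_ ?_ ?_ invol, ofLeftAction_isInvolutive invol,
    isBraidedHom_of_lact hl⟩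
  · intro a
    obtain ⟨a, rfl⟩ := hf a
    rw [← map_one f, hl, B.left_one]
  · intro u
    obtain ⟨u, rfl⟩ := hf u
    rw [← map_one f, hl, B.one_left]
  · intro a b u
    obtain ⟨a, rfl⟩ := hf a
    obtain ⟨b, rfl⟩ := hf b
    obtain ⟨u, rfl⟩ := hf u
    rw [← map_mul, hl, hl, hl, B.mul_left]
  · intro a u v
    obtain ⟨a, rfl⟩ := hf a
    obtain ⟨u, rfl⟩ := hf u
    obtain ⟨v, rfl⟩ := hf v
    rw [hr, ← map_mul, hl, hl, hl, B.left_mul, map_mul]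

variable {X : Type*} {r : X × X → X × X}

theorem Extends.lact_gen {B : BraidedGroup (YBGroup r)} (hB : B.Extends) (x y : X) :
    lact B.σ (gen r x) (gen r y) = gen r (lact r x y) :=
  congrArg Prod.fst (hB x y)

theorem Extends.ract_gen {B : BraidedGroup (YBGroup r)} (hB : B.Extends) (x y : X) :
    ract B.σ (gen r x) (gen r y) = gen r (ract r x y) :=
  congrArg Prod.snd (hB x y)

/-- Right nondegeneracy lets `y⁻¹` undo the right action of `y` on `X`; expanding the action of `z`
on `y y⁻¹ = 1` then gives the left action on `y⁻¹`. Both values depend only on `r`. -/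
theorem Extends.exists_ract_gen_gen_inv (hr : IsSolution r) {B : BraidedGroup (YBGroup r)}
    (hB : B.Extends) (x y : X) : ∃ z, ract r z y = x ∧
      ract B.σ (gen r x) (gen r y)⁻¹ = gen r z ∧
      lact B.σ (gen r x) (gen r y)⁻¹ = (gen r (lact r z y))⁻¹ := by
  obtain ⟨z, hz⟩ := (hr.right_bijective y).2 x
  refine ⟨z, hz, ?_, ?_⟩
  · rw [← hz, ← hB.ract_gen, ← B.right_mul, mul_inv_cancel, B.right_one]
  · have h := B.left_mul (gen r z) (gen r y) (gen r y)⁻¹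
    rw [mul_inv_cancel, B.left_one, hB.lact_gen, hB.ract_gen] at h
    rw [← hz, eq_inv_iff_mul_eq_one, ← mul_eq_one_comm]
    exact h.symm

/-- A braided group structure on `G(X, r)` is determined by its restriction to `X`. -/
theorem Extends.eq (hr : IsSolution r) {B C : BraidedGroup (YBGroup r)} (hB : B.Extends)
    (hC : C.Extends) : B = C := by
  -- The induction on `u` must also carry that `xᵘ` is again a generator, the same one for both
  -- structures, since `left_mul` lets it act on the next letter.
  have hgen : ∀ u x, lact B.σ (gen r x) u = lact C.σ (gen r x) u ∧
      ∃ z, ract B.σ (gen r x) u = gen r z ∧ ract C.σ (gen r x) u = gen r z := by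
    intro u
    induction u using gen_induction with
    | one => exact fun x => ⟨by rw [B.left_one, C.left_one], x, B.right_one _, C.right_one _⟩
    | mul g y ih =>
      intro x
      obtain ⟨h, z, hBz, hCz⟩ := ih x
      refine ⟨?_, ract r z y, ?_, ?_⟩
      · rw [B.left_mul, C.left_mul, h, hBz, hCz, hB.lact_gen, hC.lact_gen]
      · rw [B.right_mul, hBz, hB.ract_gen]
      · rw [C.right_mul, hCz, hC.ract_gen]
    | mul_inv g y ih =>
      intro x
      obtain ⟨h, z, hBz, hCz⟩ := ih x
      obtain ⟨w, hw, hBw, hBw'⟩ := hB.exists_ract_gen_gen_inv hr z y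
      obtain ⟨w', hw', hCw, hCw'⟩ := hC.exists_ract_gen_gen_inv hr z y
      obtain rfl := (hr.right_bijective y).1 (hw.trans hw'.symm)
      refine ⟨?_, w, ?_, ?_⟩
      · rw [B.left_mul, C.left_mul, h, hBz, hCz, hBw', hCw']
      · rw [B.right_mul, hBz, hBw]
      · rw [C.right_mul, hCz, hCw]
  refine ext_lact fun a => ?_
  induction a using gen_induction with
  | one => intro u; rw [B.one_left, C.one_left]
  | mul g y ih => intro u; rw [B.mul_left, C.mul_left, (hgen u y).1, ih]
  | mul_inv g y ih =>
    intro u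
    have h : lact B.σ (gen r y)⁻¹ u = lact C.σ (gen r y)⁻¹ u := by
      conv_lhs => rw [← C.lact_lact_inv (gen r y) u, ← (hgen _ y).1, lact_inv_lact]
    rw [B.mul_left, C.mul_left, h, ih]

end BraidedGroup

/-! ### The canonical braided structure, its socle, and the subgroup of `p`-th powers -/

section Structure

variable {X : Type*} {r : X × X → X × X} (hr : IsSolution r) (hsf : IsSquareFree r)

/-- With `w = ᵃu` and `w⁻¹ a u = aᵘ`, these are involutivity and the rule for `ᵃ(uv)` in cocycle
coordinates. The first amounts to commutativity of addition in `ℤ^(X)`. -/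
theorem cocycle_inv_mul_self (a u w : YBGroup r) (v : X →₀ ℤ)
    (hw : cocycle hr w = Finsupp.mapDomain (leftAction hr a) (cocycle hr u)) :
    Finsupp.mapDomain (leftAction hr w) (cocycle hr (w⁻¹ * (a * u))) = cocycle hr a ∧
      Finsupp.mapDomain (leftAction hr w) (Finsupp.mapDomain (leftAction hr (w⁻¹ * (a * u))) v) =
        Finsupp.mapDomain (leftAction hr a) (Finsupp.mapDomain (leftAction hr u) v) := by
  constructor
  · have h := cocycle_mul hr w (w⁻¹ * (a * u))
    rw [mul_inv_cancel_left, cocycle_mul, hw, add_comm] at h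
    exact (add_left_cancel h).symm
  · rw [← mapDomain_leftAction_mul, ← mapDomain_leftAction_mul, mul_inv_cancel_left]

/-- The canonical braided group structure on `G(X, r)`. -/
noncomputable def braidedGroup [Fintype X] : BraidedGroup (YBGroup r) :=
  BraidedGroup.ofLeftAction
    (fun a u => (cocycleEquiv hr hsf).symm (Finsupp.mapDomain (leftAction hr a) (cocycle hr u)))
    (fun a => cocycle_injective hr hsf (by rw [cocycle_cocycleEquiv_symm]; simp))
    (fun u => cocycle_injective hr hsf (by rw [cocycle_cocycleEquiv_symm]; simp))
    (fun a b u => cocycle_injective hr hsf (by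
      simp only [cocycle_cocycleEquiv_symm, mapDomain_leftAction_mul]))
    (fun a u v => cocycle_injective hr hsf (by
      simp only [cocycle_cocycleEquiv_symm, cocycle_mul, Finsupp.mapDomain_add]
      rw [(cocycle_inv_mul_self hr a u _ _ (cocycle_cocycleEquiv_symm hr hsf _)).2]))
    (fun a u => cocycle_injective hr hsf (by
      rw [cocycle_cocycleEquiv_symm]
      exact (cocycle_inv_mul_self hr a u _ 0 (cocycle_cocycleEquiv_symm hr hsf _)).1))

theorem braidedGroup_isInvolutive [Fintype X] : (braidedGroup hr hsf).IsInvolutive :=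
  BraidedGroup.ofLeftAction_isInvolutive _

theorem cocycle_lact [Fintype X] (a u : YBGroup r) :
    cocycle hr (lact (braidedGroup hr hsf).σ a u) =
      Finsupp.mapDomain (leftAction hr a) (cocycle hr u) :=
  cocycle_cocycleEquiv_symm hr hsf _

theorem braidedGroup_extends [Fintype X] : (braidedGroup hr hsf).Extends := by
  intro x y
  have h : lact (braidedGroup hr hsf).σ (gen r x) (gen r y) = gen r (r (x, y)).1 :=
    cocycle_injective hr hsf (by
      rw [cocycle_lact, leftAction_gen, cocycle_gen, cocycle_gen, Finsupp.mapDomain_single]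
      rfl)
  refine Prod.ext h ?_
  change ract (braidedGroup hr hsf).σ (gen r x) (gen r y) = gen r (r (x, y)).2
  rw [BraidedGroup.ract_eq, h, inv_mul_eq_iff_eq_mul, ← gen_mul_gen r (x, y)]

theorem socle_braidedGroup [Fintype X] : (braidedGroup hr hsf).socle = (leftAction hr).ker := by
  ext a
  rw [BraidedGroup.mem_socle, MonoidHom.mem_ker]
  constructor
  · intro h
    ext x
    have hx := congrArg (cocycle hr) (h (gen r x))
    rw [cocycle_lact, cocycle_gen, Finsupp.mapDomain_single] at hx
    exact Finsupp.single_left_injective one_ne_zero hx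
  · intro h u
    exact cocycle_injective hr hsf (by rw [cocycle_lact, h]; simp)

theorem cocycle_mul_inv_self (g : YBGroup r) :
    cocycle hr g + Finsupp.mapDomain (leftAction hr g) (cocycle hr g⁻¹) = 0 := by
  rw [← cocycle_mul, mul_inv_cancel, cocycle_one]

/-- Since `gh` acts as `g`, the contributions of `g` and `g⁻¹` to `c(g h g⁻¹)` cancel. Inside `ker
𝓛`, normality and invariance under the left action therefore coincide. -/
theorem lact_eq_conj [Fintype X] (g : YBGroup r) {h : YBGroup r} (hh : leftAction hr h = 1) :
    lact (braidedGroup hr hsf).σ g h = g * h * g⁻¹ :=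
  cocycle_injective hr hsf (by
    rw [cocycle_lact, cocycle_mul, cocycle_mul, mapDomain_leftAction_mul, hh, Equiv.Perm.coe_one,
      Finsupp.mapDomain_id, add_right_comm, cocycle_mul_inv_self, zero_add])

theorem socle_isIdeal [Fintype X] :
    (braidedGroup hr hsf).IsIdeal (braidedGroup hr hsf).socle := by
  rw [socle_braidedGroup]
  refine ⟨inferInstance, fun g h hh => ?_⟩
  rw [lact_eq_conj hr hsf g (MonoidHom.mem_ker.1 hh)]
  exact (MonoidHom.normal_ker _).conj_mem h hh g

include hsf in
theorem cocycle_gen_pow (x : X) (m : ℕ) :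
    cocycle hr (gen r x ^ m) = Finsupp.single x (m : ℤ) := by
  induction m with
  | zero => simp
  | succ m ih =>
    have hx : (leftPerm hr x ^ m) x = x := by
      rw [Equiv.Perm.pow_apply_eq_self_of_apply_eq_self (leftPerm_self hr hsf x)]
    rw [pow_succ, cocycle_mul_gen, ih, map_pow, leftAction_gen, hx, ← Finsupp.single_add,
      Nat.cast_succ]

variable {p : ℕ}

theorem powSubgroup_le_ker (hp : ∀ x, leftPerm hr x ^ p = 1) :
    powSubgroup r p ≤ (leftAction hr).ker := by
  rw [powSubgroup, Subgroup.closure_le]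
  rintro _ ⟨x, rfl⟩
  simp [MonoidHom.mem_ker, hp]

/-- The cocycle is a homomorphism on the subgroup generated by the `p`-th powers. -/
noncomputable def powCocycle (hp : ∀ x, leftPerm hr x ^ p = 1) :
    powSubgroup r p →* Multiplicative (X →₀ ℤ) where
  toFun g := Multiplicative.ofAdd (cocycle hr g)
  map_one' := by simp
  map_mul' g h := by
    rw [Subgroup.coe_mul, cocycle_mul, MonoidHom.mem_ker.1 (powSubgroup_le_ker hr hp g.2)]
    simp

theorem gen_pow_mem (x : X) : gen r x ^ p ∈ powSubgroup r p :=
  Subgroup.subset_closure ⟨x, rfl⟩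

include hsf in
theorem exists_mem_powSubgroup (hp : ∀ x, leftPerm hr x ^ p = 1) (v : X →₀ ℤ) :
    ∃ g ∈ powSubgroup r p, cocycle hr g = p • v := by
  suffices h : Multiplicative.ofAdd (p • v) ∈ (powCocycle hr hp).range by
    obtain ⟨g, hg⟩ := h
    exact ⟨g, g.2, Multiplicative.ofAdd.injective hg⟩
  induction v using Finsupp.induction_linear with
  | zero => rw [smul_zero]; exact one_mem _
  | add v w hv hw => rw [smul_add]; exact mul_mem hv hw
  | single x m =>
    refine ⟨⟨gen r x ^ p, gen_pow_mem x⟩ ^ m, ?_⟩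
    rw [map_zpow]
    refine congrArg Multiplicative.ofAdd (?_ : m • cocycle hr (gen r x ^ p) = _)
    rw [cocycle_gen_pow hr hsf]
    simp [mul_comm]

include hsf in
theorem mem_powSubgroup_iff [Fintype X] (hp : ∀ x, leftPerm hr x ^ p = 1) (g : YBGroup r) :
    g ∈ powSubgroup r p ↔ ∃ v, cocycle hr g = p • v := by
  constructor
  · intro hg
    induction hg using Subgroup.closure_induction with
    | mem g hg =>
      obtain ⟨x, rfl⟩ := hg
      exact ⟨Finsupp.single x 1, by rw [cocycle_gen_pow hr hsf]; simp⟩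
    | one => exact ⟨0, by simp⟩
    | mul g h hg _ ihg ihh =>
      obtain ⟨v, hv⟩ := ihg
      obtain ⟨w, hw⟩ := ihh
      refine ⟨v + w, ?_⟩
      rw [cocycle_mul, MonoidHom.mem_ker.1 (powSubgroup_le_ker hr hp hg), hv, hw]
      simp
    | inv g hg ihg =>
      obtain ⟨v, hv⟩ := ihg
      refine ⟨-v, ?_⟩
      have h := cocycle_mul_inv_self hr g
      rw [MonoidHom.mem_ker.1 (powSubgroup_le_ker hr hp hg), hv, Equiv.Perm.coe_one,
        Finsupp.mapDomain_id] at h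
      rw [smul_neg, eq_neg_iff_add_eq_zero, add_comm, h]
  · rintro ⟨v, hv⟩
    obtain ⟨h, hh, hv'⟩ := exists_mem_powSubgroup hr hsf hp v
    rwa [← cocycle_injective hr hsf (hv'.trans hv.symm)]

include hr hsf in
theorem powSubgroup_isIdeal [Fintype X] (hp : ∀ x, leftPerm hr x ^ p = 1) :
    (braidedGroup hr hsf).IsIdeal (powSubgroup r p) := by
  have hl : ∀ g, ∀ h ∈ powSubgroup r p, lact (braidedGroup hr hsf).σ g h ∈ powSubgroup r p := by
    intro g h hh
    rw [mem_powSubgroup_iff hr hsf hp] at hh ⊢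
    obtain ⟨v, hv⟩ := hh
    refine ⟨Finsupp.mapDomain (leftAction hr g) v, ?_⟩
    rw [cocycle_lact, hv, Finsupp.mapDomain_smul]
  refine ⟨⟨fun h hh g => ?_⟩, hl⟩
  rw [← lact_eq_conj hr hsf g (MonoidHom.mem_ker.1 (powSubgroup_le_ker hr hp hh))]
  exact hl g h hh

theorem powSubgroup_le_socle [Fintype X] (hp : ∀ x, leftPerm hr x ^ p = 1) :
    powSubgroup r p ≤ (braidedGroup hr hsf).socle := by
  rw [socle_braidedGroup]
  exact powSubgroup_le_ker hr hp

include hsf in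
/-- The subgroup generated by the `p`-th powers is free abelian on these powers. -/
theorem exists_powSubgroup_mulEquiv [Fintype X] (hp : ∀ x, leftPerm hr x ^ p = 1) (hp0 : p ≠ 0) :
    ∃ f : Multiplicative (X →₀ ℤ) ≃* powSubgroup r p,
      ∀ x : X, (f (Multiplicative.ofAdd (Finsupp.single x 1)) : YBGroup r) = gen r x ^ p := by
  have hinj : Function.Injective (powCocycle hr hp) := fun g h hgh =>
    Subtype.ext (cocycle_injective hr hsf (Multiplicative.ofAdd.injective hgh))
  -- The map `s` inverts the cocycle on `p ℤ^(X)`. It is multiplicative because `powCocycle` is an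
  -- injective homomorphism; `p ≠ 0` makes it injective.
  choose s hs hcs using exists_mem_powSubgroup hr hsf hp
  let f : Multiplicative (X →₀ ℤ) →* powSubgroup r p :=
    { toFun := fun v => ⟨s v.toAdd, hs _⟩
      map_one' := hinj (congrArg Multiplicative.ofAdd
        ((hcs _).trans (by simp) : cocycle hr _ = cocycle hr 1))
      map_mul' := fun v w => hinj <|
        (congrArg Multiplicative.ofAdd (by simp only [hcs, toAdd_mul, smul_add] :
          cocycle hr (s (v * w).toAdd) = cocycle hr (s v.toAdd) + cocycle hr (s w.toAdd))).trans
        (map_mul (powCocycle hr hp) ⟨s v.toAdd, hs _⟩ ⟨s w.toAdd, hs _⟩).symm }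
  refine ⟨MulEquiv.ofBijective f ⟨fun v w hvw => ?_, fun g => ?_⟩, fun x => ?_⟩
  · have h : s v.toAdd = s w.toAdd := congrArg Subtype.val hvw
    have h' := congrArg (cocycle hr) h
    rw [hcs, hcs] at h'
    exact Multiplicative.toAdd.injective (smul_right_injective _ hp0 h')
  · obtain ⟨v, hv⟩ := (mem_powSubgroup_iff hr hsf hp g).1 g.2
    exact ⟨Multiplicative.ofAdd v,
      Subtype.ext (cocycle_injective hr hsf ((hcs v).trans hv.symm))⟩
  · refine cocycle_injective hr hsf ((hcs _).trans ?_)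
    rw [cocycle_gen_pow hr hsf, toAdd_ofAdd]
    simp

/-- The reduction of the cocycle modulo `p`. -/
noncomputable def residue (p : ℕ) (g : YBGroup r) (x : X) : ZMod p := (cocycle hr g x : ZMod p)

theorem residue_eq_iff_exists {g h : YBGroup r} :
    residue hr p g = residue hr p h ↔ ∃ v, cocycle hr h - cocycle hr g = p • v := by
  simp only [funext_iff, residue, ZMod.intCast_eq_intCast_iff_dvd_sub]
  constructor
  · intro H
    refine ⟨(cocycle hr h - cocycle hr g).mapRange (· / (p : ℤ)) (Int.zero_ediv _), ?_⟩
    ext x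
    simp [Int.mul_ediv_cancel' (H x)]
  · rintro ⟨v, hv⟩ x
    exact ⟨v x, by rw [← Finsupp.sub_apply, hv]; simp⟩

include hsf in
-- The difference `c(h) - c(g)` equals `𝓛_g c(g⁻¹h)`, and permuting coordinates preserves
-- divisibility by `p`.
theorem residue_eq_iff [Fintype X] (hp : ∀ x, leftPerm hr x ^ p = 1) {g h : YBGroup r} :
    residue hr p g = residue hr p h ↔ g⁻¹ * h ∈ powSubgroup r p := by
  rw [residue_eq_iff_exists, mem_powSubgroup_iff hr hsf hp]
  have key : cocycle hr h - cocycle hr g =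
      Finsupp.mapDomain (leftAction hr g) (cocycle hr (g⁻¹ * h)) := by
    rw [sub_eq_iff_eq_add', ← cocycle_mul, mul_inv_cancel_left]
  constructor
  · rintro ⟨v, hv⟩
    refine ⟨Finsupp.mapDomain (leftAction hr g⁻¹) v, ?_⟩
    rw [← Finsupp.mapDomain_smul, ← hv, key, ← mapDomain_leftAction_mul, inv_mul_cancel]
    simp
  · rintro ⟨v, hv⟩
    exact ⟨Finsupp.mapDomain (leftAction hr g) v, by rw [key, hv, Finsupp.mapDomain_smul]⟩

include hsf in
theorem residue_surjective [Fintype X] (p : ℕ) : Function.Surjective (residue hr p) := by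
  intro f
  choose v hv using fun x => ZMod.intCast_surjective (f x)
  obtain ⟨g, hg⟩ := cocycle_surjective hr hsf (Finsupp.equivFunOnFinite.symm v)
  exact ⟨g, funext fun x => by simp [residue, hg, hv]⟩

include hr hsf in
theorem card_quotient_powSubgroup [Fintype X] (hp : ∀ x, leftPerm hr x ^ p = 1) :
    Nat.card (YBGroup r ⧸ powSubgroup r p) = p ^ Fintype.card X := by
  let F : YBGroup r ⧸ powSubgroup r p → X → ZMod p :=
    Quotient.lift (residue hr p) fun g h hgh =>
      (residue_eq_iff hr hsf hp).2 (QuotientGroup.leftRel_apply.1 hgh)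
  have hF : Function.Bijective F := by
    constructor
    · intro a b
      refine QuotientGroup.induction_on a fun g => QuotientGroup.induction_on b fun h hgh => ?_
      exact QuotientGroup.eq.2 ((residue_eq_iff hr hsf hp).1 hgh)
    · intro f
      obtain ⟨g, hg⟩ := residue_surjective hr hsf p f
      exact ⟨QuotientGroup.mk g, hg⟩
  rw [Nat.card_congr (Equiv.ofBijective F hF), Nat.card_fun, Nat.card_zmod,
    Nat.card_eq_fintype_card]

include hr hsf in
theorem injective_mk_gen [Fintype X] (hp : ∀ x, leftPerm hr x ^ p = 1) (h2 : 2 ≤ p) :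
    Function.Injective fun x : X => (gen r x : YBGroup r ⧸ powSubgroup r p) := by
  intro x y hxy
  have : Fact (1 < p) := ⟨h2⟩
  have h := congrFun ((residue_eq_iff hr hsf hp).2 (QuotientGroup.eq.1 hxy)) y
  by_contra hne
  simp [residue, hne] at h

end Structure

/-! ### Ordered monomials as a transversal of `𝓕_p` -/

section BoxMonomials

variable {X : Type*} {r : X × X → X × X}

/-- The ordered monomial with exponents `α` in `G(X, r)`. -/
def groupMonomial (r : X × X → X × X) {n : ℕ} (e : Fin n ≃ X) (α : Fin n → ℕ) : YBGroup r :=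
  (List.ofFn fun i : Fin n => gen r (e i) ^ α i).prod

/-- The canonical homomorphism from the Yang-Baxter algebra to the group algebra. -/
noncomputable def toGroupAlgebra (k : Type*) [Field k] (r : X × X → X × X) :
    YBAlgebra k r →ₐ[k] MonoidAlgebra k (YBGroup r) :=
  RingQuot.liftAlgHom k ⟨FreeAlgebra.lift k fun x => MonoidAlgebra.of k _ (gen r x), by
    rintro _ _ ⟨q⟩
    simp only [map_mul, FreeAlgebra.lift_ι_apply]
    rw [← map_mul, ← map_mul, gen_mul_gen]⟩

theorem toGroupAlgebra_algGen (k : Type*) [Field k] (x : X) :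
    toGroupAlgebra k r (algGen k r x) = MonoidAlgebra.of k _ (gen r x) := by
  rw [toGroupAlgebra, algGen, RingQuot.liftAlgHom_mkAlgHom_apply, FreeAlgebra.lift_ι_apply]

theorem toGroupAlgebra_orderedMonomial (k : Type*) [Field k] {n : ℕ} (e : Fin n ≃ X)
    (α : Fin n → ℕ) : toGroupAlgebra k r (orderedMonomial k r e α) =
      MonoidAlgebra.of k _ (groupMonomial r e α) := by
  simp only [orderedMonomial, groupMonomial, map_list_prod, List.map_ofFn, Function.comp_def,
    map_pow, toGroupAlgebra_algGen]

/-- Mapping the algebra to `k[G]` puts the positive word `g` in the span of the ordered monomials of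
`G`. Distinct group elements are linearly independent in `k[G]`, so `g` is itself one of these
monomials. -/
theorem IsBinomialEnumeration.exists_groupMonomial {k : Type*} [Field k] {n : ℕ} {e : Fin n ≃ X}
    (he : IsBinomialEnumeration k r e) {g : YBGroup r}
    (hg : g ∈ Submonoid.closure (Set.range (gen r))) : ∃ α, groupMonomial r e α = g := by
  have h₁ : MonoidAlgebra.of k _ g ∈ (toGroupAlgebra k r).range := by
    induction hg using Submonoid.closure_induction with
    | mem g hg =>
      obtain ⟨x, rfl⟩ := hg
      exact ⟨algGen k r x, toGroupAlgebra_algGen k x⟩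
    | one => rw [map_one]; exact one_mem _
    | mul g h _ _ ihg ihh => rw [map_mul]; exact mul_mem ihg ihh
  obtain ⟨a, ha⟩ := h₁
  have h₂ : a ∈ Submodule.span k (Set.range (orderedMonomial k r e)) :=
    he.span_eq_top ▸ Submodule.mem_top
  have h₃ := Submodule.mem_map_of_mem (f := (toGroupAlgebra k r).toLinearMap) h₂
  rw [Submodule.map_span, ← Set.range_comp] at h₃
  have h₄ : (toGroupAlgebra k r).toLinearMap ∘ orderedMonomial k r e =
      MonoidAlgebra.of k _ ∘ groupMonomial r e :=
    funext fun α => toGroupAlgebra_orderedMonomial k e α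
  rw [h₄, Set.range_comp] at h₃
  have h₅ : g ∈ Set.range (groupMonomial r e) :=
    (MonoidAlgebra.of_mem_span_of_iff (R := k)).1 (ha ▸ h₃)
  exact h₅

variable {p : ℕ}

/-- Modulo `𝓕_p` the inverse of a generator is its power `p - 1`, so positive words represent all
classes. -/
theorem exists_mem_closure_mk_eq [(powSubgroup r p).Normal] (hp0 : p ≠ 0) (g : YBGroup r) :
    ∃ w ∈ Submonoid.closure (Set.range (gen r)),
      QuotientGroup.mk' (powSubgroup r p) w = QuotientGroup.mk' (powSubgroup r p) g := by
  have hx : ∀ x, gen r x ∈ Submonoid.closure (Set.range (gen r)) := fun x =>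
    Submonoid.subset_closure ⟨x, rfl⟩
  induction g using gen_induction with
  | one => exact ⟨1, one_mem _, rfl⟩
  | mul g x ih =>
    obtain ⟨w, hw, h⟩ := ih
    exact ⟨w * gen r x, mul_mem hw (hx x), by rw [map_mul, map_mul, h]⟩
  | mul_inv g x ih =>
    obtain ⟨w, hw, h⟩ := ih
    refine ⟨w * gen r x ^ (p - 1), mul_mem hw (pow_mem (hx x) _), ?_⟩
    rw [map_mul, map_mul, h, mul_right_inj, map_inv, eq_inv_iff_mul_eq_one, ← map_mul, ← pow_succ,
      Nat.sub_one_add_one hp0]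
    exact (QuotientGroup.eq_one_iff _).2 (gen_pow_mem x)

theorem mk_groupMonomial_mod [(powSubgroup r p).Normal] {n : ℕ} (e : Fin n ≃ X) (α : Fin n → ℕ) :
    QuotientGroup.mk' (powSubgroup r p) (groupMonomial r e fun i => α i % p) =
      QuotientGroup.mk' (powSubgroup r p) (groupMonomial r e α) := by
  have h : ∀ x, QuotientGroup.mk' (powSubgroup r p) (gen r x) ^ p = 1 := fun x => by
    rw [← map_pow]
    exact (QuotientGroup.eq_one_iff _).2 (gen_pow_mem x)
  simp only [groupMonomial, map_list_prod, List.map_ofFn, Function.comp_def, map_pow,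
    ← pow_eq_pow_mod _ (h _)]

/-- The box monomials are a transversal of the subgroup generated by the `p`-th powers. -/
theorem IsBinomialEnumeration.bijOn_boxMonomials {k : Type*} [Field k] {n : ℕ} {e : Fin n ≃ X}
    (he : IsBinomialEnumeration k r e) [(powSubgroup r p).Normal] (hp0 : p ≠ 0)
    (hcard : Nat.card (YBGroup r ⧸ powSubgroup r p) = p ^ n) :
    Set.BijOn (QuotientGroup.mk' (powSubgroup r p)) (boxMonomials r p e) Set.univ := by
  let F : (Fin n → Fin p) → YBGroup r ⧸ powSubgroup r p := fun α =>
    QuotientGroup.mk' (powSubgroup r p) (groupMonomial r e fun i => α i)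
  have hsurj : Function.Surjective F := by
    intro a
    obtain ⟨g, rfl⟩ := QuotientGroup.mk'_surjective _ a
    obtain ⟨w, hw, hwg⟩ := exists_mem_closure_mk_eq hp0 g
    obtain ⟨α, rfl⟩ := he.exists_groupMonomial hw
    refine ⟨fun i => ⟨α i % p, Nat.mod_lt _ (Nat.pos_of_ne_zero hp0)⟩, ?_⟩
    rw [← hwg, ← mk_groupMonomial_mod]
  -- Source and target both have `pⁿ` elements, so surjectivity suffices.
  have hbij : Function.Bijective F :=
    hsurj.bijective_of_nat_card_le (by rw [hcard]; simp)
  refine ⟨Set.mapsTo_univ _ _, ?_, ?_⟩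
  · rintro _ ⟨α, hα, rfl⟩ _ ⟨β, hβ, rfl⟩ h
    have h' := hbij.1 (a₁ := fun i => ⟨α i, hα i⟩) (a₂ := fun i => ⟨β i, hβ i⟩) h
    have : α = β := funext fun i => congrArg Fin.val (congrFun h' i)
    rw [this]
  · intro a _
    obtain ⟨α, rfl⟩ := hbij.2 a
    exact ⟨_, ⟨fun i => α i, fun i => (α i).2, rfl⟩, rfl⟩

end BoxMonomials

/-! ### The cyclic degree and generalities on quotients -/

section CyclicDegree

variable {X : Type*} [Fintype X] {r : X × X → X × X} (hr : IsSolution r)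

theorem leftPerm_pow_cyclicDegree (x : X) : leftPerm hr x ^ cyclicDegree hr = 1 :=
  orderOf_dvd_iff_pow_eq_one.1
    (Finset.dvd_lcm (f := fun x => orderOf (leftPerm hr x)) (Finset.mem_univ x))

theorem cyclicDegree_ne_zero : cyclicDegree hr ≠ 0 := by
  rw [cyclicDegree, Ne, Finset.lcm_eq_zero_iff]
  rintro ⟨x, -, hx⟩
  exact (orderOf_pos (leftPerm hr x)).ne' hx

end CyclicDegree

theorem closure_range_mk_gen {X : Type*} {r : X × X → X × X} (N : Subgroup (YBGroup r))
    [N.Normal] : Subgroup.closure (Set.range fun x : X => QuotientGroup.mk' N (gen r x)) = ⊤ := by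
  rw [show (fun x : X => QuotientGroup.mk' N (gen r x)) = QuotientGroup.mk' N ∘ gen r from rfl,
    Set.range_comp, ← MonoidHom.map_closure, closure_range_gen, ← MonoidHom.range_eq_map,
    MonoidHom.range_eq_top]
  exact QuotientGroup.mk'_surjective N

theorem exists_unique_mul_of_bijOn {G : Type*} [Group G] {N : Subgroup G} [N.Normal] {Y : Set G}
    (hY : Set.BijOn (QuotientGroup.mk' N) Y Set.univ) (g : G) :
    ∃ t ∈ Y, ∃ w ∈ N, g = t * w ∧ (∀ t' ∈ Y, ∀ w' ∈ N, g = t' * w' → t' = t ∧ w' = w) ∧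
      QuotientGroup.mk' N g = QuotientGroup.mk' N t := by
  obtain ⟨t, ht, htg⟩ := hY.surjOn (Set.mem_univ (QuotientGroup.mk' N g))
  refine ⟨t, ht, t⁻¹ * g, QuotientGroup.eq.1 htg, by group, ?_, htg.symm⟩
  rintro t' ht' w' hw' rfl
  have h₁ : QuotientGroup.mk' N w' = 1 := (QuotientGroup.eq_one_iff w').2 hw'
  obtain rfl : t' = t := hY.injOn ht' ht (by rw [htg, map_mul, h₁, mul_one])
  exact ⟨rfl, by group⟩

end YBE

/-! ### Assembly of the main theorem -/

theorem theoremB {X : Type*} [Fintype X] (r : X × X → X × X)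
    (hr : IsSolution r) (hsf : IsSquareFree r)
    (n p : ℕ) (hn : Fintype.card X = n) (hp : cyclicDegree hr = p)
    (k : Type*) [Field k] :
    -- the braided group `(G, r_G)` associated to `(X, r)`
    ∃ B : BraidedGroup (YBGroup r),
      (B.Extends ∧ B.IsInvolutive ∧
        ∀ B' : BraidedGroup (YBGroup r), B'.Extends → B' = B) ∧
      -- (1) the chain of ideals; `𝓕_p` is free abelian on the `p`-th powers of the generators
      B.IsIdeal (powSubgroup r p) ∧ B.IsIdeal B.socle ∧ powSubgroup r p ≤ B.socle ∧
      (∃ f : Multiplicative (X →₀ ℤ) ≃* powSubgroup r p,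
        ∀ x : X, (f (Multiplicative.ofAdd (Finsupp.single x 1)) : YBGroup r) = gen r x ^ p) ∧
      ∃ (_ : (powSubgroup r p).Normal) (_ : B.socle.Normal),
      -- (2) the quotient braided group
      ∃ Bq : BraidedGroup (YBGroup r ⧸ powSubgroup r p),
        Bq.IsInvolutive ∧
        B.IsBraidedHom Bq (QuotientGroup.mk' (powSubgroup r p)) ∧
        Nat.card (YBGroup r ⧸ powSubgroup r p) = p ^ n ∧
        (∀ e : Fin n ≃ X, IsBinomialEnumeration k r e →
          Set.BijOn (QuotientGroup.mk' (powSubgroup r p)) (boxMonomials r p e) Set.univ ∧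
          (boxMonomials r p e).ncard = p ^ n ∧
          ∀ y ∈ boxMonomials r p e, ∀ z ∈ boxMonomials r p e,
            ∃ t ∈ boxMonomials r p e, ∃ W ∈ powSubgroup r p,
              y * z = t * W ∧
              (∀ t' ∈ boxMonomials r p e, ∀ W' ∈ powSubgroup r p,
                y * z = t' * W' → t' = t ∧ W' = W) ∧
              QuotientGroup.mk' (powSubgroup r p) y * QuotientGroup.mk' (powSubgroup r p) z =
                QuotientGroup.mk' (powSubgroup r p) t) ∧
        -- (3) `X` embeds and generates
        (n ≤ 1 ∨ 2 ≤ p →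
          Function.Injective fun x : X => QuotientGroup.mk' (powSubgroup r p) (gen r x)) ∧
        (∀ x y : X,
          Bq.σ (QuotientGroup.mk' (powSubgroup r p) (gen r x),
              QuotientGroup.mk' (powSubgroup r p) (gen r y)) =
            (QuotientGroup.mk' (powSubgroup r p) (gen r (r (x, y)).1),
              QuotientGroup.mk' (powSubgroup r p) (gen r (r (x, y)).2))) ∧
        Subgroup.closure
          (Set.range fun x : X => QuotientGroup.mk' (powSubgroup r p) (gen r x)) = ⊤ ∧
      -- (4) the braided groups `𝒢 ≃ G / Γ` and the canonical epimorphism onto `𝒢`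
      ∃ (BΓ : BraidedGroup (YBGroup r ⧸ B.socle)) (B𝒢 : BraidedGroup (permGroup hr)),
        BΓ.IsInvolutive ∧ B.IsBraidedHom BΓ (QuotientGroup.mk' B.socle) ∧
        B𝒢.IsInvolutive ∧ B.IsBraidedHom B𝒢 (leftAction hr).rangeRestrict ∧
        (∃ φ : (YBGroup r ⧸ B.socle) ≃* permGroup hr,
          BΓ.IsBraidedHom B𝒢 φ.toMonoidHom ∧
          ∀ g : YBGroup r, φ (QuotientGroup.mk' B.socle g) = (leftAction hr).rangeRestrict g) ∧
        (∃ ψ : (YBGroup r ⧸ powSubgroup r p) →* permGroup hr,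
          Function.Surjective ψ ∧ Bq.IsBraidedHom B𝒢 ψ ∧
          ∀ g : YBGroup r,
            ψ (QuotientGroup.mk' (powSubgroup r p) g) = (leftAction hr).rangeRestrict g) ∧
        Nat.card (permGroup hr) ∣ p ^ n ∧
        (p.Prime → IsPGroup p (permGroup hr)) := by
  subst hn hp
  set p := cyclicDegree hr
  have hp : ∀ x, leftPerm hr x ^ p = 1 := leftPerm_pow_cyclicDegree hr
  have hp0 : p ≠ 0 := cyclicDegree_ne_zero hr
  have hinv := braidedGroup_isInvolutive hr hsf
  have hF := powSubgroup_isIdeal hr hsf hp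
  have hΓ := socle_isIdeal hr hsf
  have hFΓ := powSubgroup_le_socle hr hsf hp
  have hsocle := socle_braidedGroup hr hsf
  have hcard := card_quotient_powSubgroup hr hsf hp
  refine ⟨braidedGroup hr hsf, ⟨braidedGroup_extends hr hsf, hinv,
    fun B' hB' => hB'.eq hr (braidedGroup_extends hr hsf)⟩, hF, hΓ, hFΓ,
    exists_powSubgroup_mulEquiv hr hsf hp hp0, hF.1, hΓ.1, ?_⟩
  have := hF.1
  have := hΓ.1
  have hπ := QuotientGroup.mk'_surjective (powSubgroup r p)
  have hπΓ := QuotientGroup.mk'_surjective (braidedGroup hr hsf).socle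
  have hL := (leftAction hr).rangeRestrict_surjective
  obtain ⟨Bq, hBq, hBqπ⟩ := BraidedGroup.exists_isBraidedHom_of_surjective hinv
    (QuotientGroup.mk' (powSubgroup r p)) hπ
    (by rw [QuotientGroup.ker_mk']; exact hF.2) (by rw [QuotientGroup.ker_mk']; exact hFΓ)
  obtain ⟨BΓ, hBΓ, hBΓπ⟩ := BraidedGroup.exists_isBraidedHom_of_surjective hinv
    (QuotientGroup.mk' (braidedGroup hr hsf).socle) hπΓ
    (by rw [QuotientGroup.ker_mk']; exact hΓ.2) (by rw [QuotientGroup.ker_mk'])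
  -- The kernel of `𝓛` is exactly the socle, so the same descent applies to `𝒢`.
  obtain ⟨BG, hBG, hBGL⟩ := BraidedGroup.exists_isBraidedHom_of_surjective hinv
    (leftAction hr).rangeRestrict hL
    (by rw [MonoidHom.ker_rangeRestrict, ← hsocle]; exact hΓ.2)
    (by rw [MonoidHom.ker_rangeRestrict, ← hsocle])
  let φ : (YBGroup r ⧸ (braidedGroup hr hsf).socle) ≃* permGroup hr :=
    (QuotientGroup.quotientMulEquivOfEq hsocle).trans
      (QuotientGroup.quotientKerEquivRange (leftAction hr))
  let ψ : (YBGroup r ⧸ powSubgroup r p) →* permGroup hr :=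
    QuotientGroup.lift (powSubgroup r p) (leftAction hr).rangeRestrict
      fun _ hg => Subtype.ext (powSubgroup_le_ker hr hp hg)
  have hψ : ∀ g, ψ (QuotientGroup.mk' (powSubgroup r p) g) = (leftAction hr).rangeRestrict g :=
    fun _ => rfl
  have hψs : Function.Surjective ψ := fun a => by
    obtain ⟨g, rfl⟩ := hL a
    exact ⟨_, hψ g⟩
  have hdvd : Nat.card (permGroup hr) ∣ p ^ Fintype.card X :=
    hcard ▸ Subgroup.card_dvd_of_surjective ψ hψs
  refine ⟨Bq, hBq, hBqπ, hcard, fun e he => ?_, ?_, fun x y => ?_, closure_range_mk_gen _,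
    BΓ, BG, hBΓ, hBΓπ, hBG, hBGL, ⟨φ, ?_, fun _ => rfl⟩, ⟨ψ, hψs, ?_, hψ⟩, hdvd, fun hpp => ?_⟩
  · have hbij := he.bijOn_boxMonomials hp0 hcard
    refine ⟨hbij, ?_, fun y _ z _ => ?_⟩
    · rw [← hcard, ← Set.ncard_univ, ← hbij.image_eq, hbij.injOn.ncard_image]
    · rw [← map_mul]
      exact exists_unique_mul_of_bijOn hbij (y * z)
  · rintro (h1 | h2)
    · have := Fintype.card_le_one_iff_subsingleton.1 h1
      exact Function.injective_of_subsingleton _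
    · exact injective_mk_gen hr hsf hp h2
  · rw [hBqπ, braidedGroup_extends]
  · exact BraidedGroup.IsBraidedHom.of_comp hπΓ hBΓπ hBGL fun _ => rfl
  · exact BraidedGroup.IsBraidedHom.of_comp hπ hBqπ hBGL hψ
  · have := Fact.mk hpp
    obtain ⟨m, -, hm⟩ := (Nat.dvd_prime_pow hpp).1 hdvd
    exact IsPGroup.of_card hm
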